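/- A (simple) $t$-graph $G$ on a finite vertex set $V$ is a set of $t$-element subsets of $V$, called edges. Let $v=|V|$. For $\epsilon\in\mathbb R$, $G$ is called $(1-\epsilon)$-dense if every $(t-1)$-element subset of $V$ is contained in at least $(1-\epsilon)(v-t+1)$ edges of $G$. For a $t$-graph $H$, a rational decomposition of $G$ into copies of $H$ is a finite set of pairs $(H_i,w_i)$, where each $H_i$ is a (not necessarily induced) subgraph of $G$ isomorphic to $H$ and each $w_i$ is a positive rational number, such that $\sum_{i:\,T\in E(H_i)} w_i = 1$ for every edge $T$ of $G$. Let $K_k^t$ denote the complete $t$-graph on $k$ vertices. Theorem. For every integer $t\ge 2$ there is a constant $C=C(t)>0$, and for every integer $k\ge t$ there is a $v_0=v_0(t,k)$, such that the following holds. For all $v>v_0$ and all real $\epsilon< C k^{-2t}$, every $(1-\epsilon)$-dense $t$-graph $G$ on $v$ vertices admits a rational decomposition into copies of $K_k^t$. Moreover, with the same $C$ and $v_0$, $G$ admits a rational decomposition into copies of $H$ for every $t$-graph $H$ on $k$ vertices with at least one edge. -/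

import Mathlib

/-- A simple `t`-uniform hypergraph (a `t`-graph) on the vertex type `V`: a finite set of edges,
each of which is a set of exactly `t` vertices. -/
structure TGraph (t : ℕ) (V : Type*) where
  /-- the edges -/
  edges : Finset (Finset V)
  /-- every edge has exactly `t` vertices -/
  card_edge : ∀ T ∈ edges, T.card = t

namespace TGraph

/-- The complete `t`-graph on a finite vertex type. -/
def complete (t : ℕ) (V : Type*) [Fintype V] : TGraph t V where
  edges := Finset.powersetCard t Finset.univ
  card_edge := fun _ hT => (Finset.mem_powersetCard.mp hT).2

/-- The degree of a set `S` of vertices: the number of edges that contain `S`. -/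
def degree {t : ℕ} {V : Type*} [DecidableEq V] (G : TGraph t V) (S : Finset V) : ℕ :=
  (G.edges.filter (fun T => S ⊆ T)).card

/-- The minimum degree of `G` over all `s`-element sets of vertices. -/
noncomputable def minDegree {t : ℕ} {V : Type*} [DecidableEq V] (G : TGraph t V) (s : ℕ) : ℕ :=
  sInf {d : ℕ | ∃ S : Finset V, S.card = s ∧ G.degree S = d}

/-- `G` is `(1 - ε)`-dense: the minimum degree over `(t-1)`-element sets of vertices is at least
`(1 - ε) (v - t + 1)`, where `v` is the number of vertices. -/
def IsDense {t : ℕ} {V : Type*} [Fintype V] [DecidableEq V] (G : TGraph t V) (ε : ℝ) : Prop :=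
  (1 - ε) * ((Fintype.card V : ℝ) - (t : ℝ) + 1) ≤ (G.minDegree (t - 1) : ℝ)

/-- A (not necessarily induced) subgraph of `G`: a set of vertices of `G` and a set of edges
of `G` spanned by them. -/
structure Subgraph {t : ℕ} {V : Type*} (G : TGraph t V) where
  /-- the vertices of the subgraph -/
  verts : Finset V
  /-- the edges of the subgraph -/
  edges : Finset (Finset V)
  /-- the edges of the subgraph are edges of `G` -/
  edges_subset : edges ⊆ G.edges
  /-- the edges of the subgraph consist of vertices of the subgraph -/
  edge_subset_verts : ∀ T ∈ edges, T ⊆ verts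

/-- The subgraph `S` of `G` is isomorphic to the `t`-graph `H`: some bijection from the vertices
of `H` to those of `S` carries edges to edges and non-edges to non-edges. -/
def Subgraph.IsCopy {t : ℕ} {V X : Type*} {G : TGraph t V} (S : G.Subgraph)
    (H : TGraph t X) : Prop :=
  ∃ e : X ≃ {x : V // x ∈ S.verts}, ∀ T : Finset X,
    T ∈ H.edges ↔ T.map (e.toEmbedding.trans (Function.Embedding.subtype _)) ∈ S.edges

/-- `G` has a rational decomposition into copies of `H`: there is a finite set of pairs
`(H_i, w_i)`, each consisting of a subgraph of `G` isomorphic to `H` and a positive rational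
weight, such that for every edge of `G` the weights of the `H_i` having it as an edge sum
to `1`. -/
def HasRationalDecomposition {t : ℕ} {V X : Type*} [DecidableEq V]
    (G : TGraph t V) (H : TGraph t X) : Prop :=
  ∃ D : Finset (G.Subgraph × ℚ),
    (∀ p ∈ D, p.1.IsCopy H ∧ 0 < p.2) ∧
      ∀ T ∈ G.edges, ∑ p ∈ D with T ∈ p.1.edges, p.2 = 1

end TGraph

/-!
Give every `k`-clique of `G` the weight `1 / P`, where `P` is the number of `k`-sets through a
`t`-set. By density almost all of the `k`-sets through an edge are cliques, so each edge `e`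
receives a total weight slightly below `1`. This deficit is made up at `e` alone by a local
switching: the `k`-subsets of a `(k + t)`-clique `J ⊇ e` carry signed weights with total `1` through
`e` and `0` through every other `t`-subset of `J`. Averaged over all such `J`, the switchings for
all the edges together change the weight of a `k`-clique by at most `1 / P`, since for fixed `J` and
`K ⊆ J` the switchings of the `t`-subsets of `J` have absolute values at `K` summing to at most
`2 ^ t`. Hence all weights stay nonnegative. Finally, the weight of each `k`-clique is shared
equally among the copies of `H` placed on it by all bijections; by symmetry every edge of the clique
receives the same share.
-/

section PowersetCard

open Finset

variable {α M : Type*} [DecidableEq α] [AddCommMonoid M]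

theorem card_powerset_filter_card_inter_card_sdiff {A J : Finset α} (hA : A ⊆ J) (i j : ℕ) :
    #{S ∈ J.powerset | #(S ∩ A) = i ∧ #(S \ A) = j} = (#A).choose i * (#J - #A).choose j := by
  rw [← card_sdiff_of_subset hA, ← card_powersetCard i, ← card_powersetCard j, ← card_product]
  have hinter {P Q : Finset α} (hP : P ⊆ A) (hQ : Q ⊆ J \ A) : (P ∪ Q) ∩ A = P := by grind
  have hsdiff {P Q : Finset α} (hP : P ⊆ A) (hQ : Q ⊆ J \ A) : (P ∪ Q) \ A = Q := by grind
  refine card_nbij' (fun S => (S ∩ A, S \ A)) (fun p => p.1 ∪ p.2) ?_ ?_ ?_ ?_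
  · intro S hS
    simp only [coe_filter, mem_powerset, Set.mem_ofPred_eq] at hS
    simp only [coe_product, Set.mem_prod, mem_coe, mem_powersetCard]
    exact ⟨⟨inter_subset_right, hS.2.1⟩, sdiff_subset_sdiff hS.1 le_rfl, hS.2.2⟩
  · rintro ⟨P, Q⟩ h
    simp only [coe_product, Set.mem_prod, mem_coe, mem_powersetCard] at h
    simp only [coe_filter, mem_powerset, Set.mem_ofPred_eq]
    rw [hinter h.1.1 h.2.1, hsdiff h.1.1 h.2.1]
    exact ⟨union_subset (h.1.1.trans hA) (h.2.1.trans sdiff_subset), h.1.2, h.2.2⟩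
  · intro S _
    exact (union_comm _ _).trans (sdiff_union_inter S A)
  · rintro ⟨P, Q⟩ h
    simp only [coe_product, Set.mem_prod, mem_coe, mem_powersetCard] at h
    exact Prod.ext (hinter h.1.1 h.2.1) (hsdiff h.1.1 h.2.1)

theorem sum_powersetCard_card_inter {A J : Finset α} (hA : A ⊆ J) (n : ℕ) (f : ℕ → M) :
    ∑ S ∈ powersetCard n J, f #(S ∩ A) =
      ∑ p ∈ antidiagonal n, ((#A).choose p.1 * (#J - #A).choose p.2) • f p.1 := by
  have hmaps : ∀ S ∈ powersetCard n J, (#(S ∩ A), #(S \ A)) ∈ antidiagonal n := fun S hS => by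
    rw [HasAntidiagonal.mem_antidiagonal, card_inter_add_card_sdiff, (mem_powersetCard.1 hS).2]
  rw [← sum_fiberwise_of_maps_to hmaps]
  refine sum_congr rfl fun p hp => ?_
  rw [← card_powerset_filter_card_inter_card_sdiff hA, ← sum_const]
  refine sum_congr ?_ fun S hS => by rw [(mem_filter.1 hS).2.1]
  ext S
  have := card_inter_add_card_sdiff S A
  rw [HasAntidiagonal.mem_antidiagonal] at hp
  simp only [mem_filter, mem_powersetCard, mem_powerset, Prod.ext_iff]
  grind

theorem sum_powersetCard_superset {T J : Finset α} (hT : T ⊆ J) {n : ℕ} (hn : #T ≤ n)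
    (f : Finset α → M) :
    ∑ K ∈ powersetCard n J with T ⊆ K, f K = ∑ S ∈ powersetCard (n - #T) (J \ T), f (S ∪ T) := by
  rw [filter_powersetCard_subset T J n hT hn, sum_image]
  intro S hS S' hS' h
  simp only [mem_coe, mem_powersetCard] at hS hS'
  have hsdiff {A : Finset α} (hA : A ⊆ J \ T) : (A ∪ T) \ T = A := by grind
  rw [← hsdiff hS.1, ← hsdiff hS'.1]
  exact congrArg (· \ T) h

end PowersetCard

theorem coeff_one_sub_X_pow {R : Type*} [CommRing R] (s n : ℕ) :
    PowerSeries.coeff n ((1 - PowerSeries.X : PowerSeries R) ^ s) = (-1) ^ n * s.choose n := by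
  have h : (1 - PowerSeries.X : PowerSeries R) ^ s =
      PowerSeries.rescale (-1) (((1 + Polynomial.X) ^ s : Polynomial R) : PowerSeries R) := by
    simp [sub_eq_add_neg]
  rw [h, PowerSeries.coeff_rescale, Polynomial.coeff_coe, Polynomial.coeff_one_add_X_pow]

open Finset in
theorem sum_antidiagonal_neg_one_pow_mul_choose_mul_choose {R : Type*} [CommRing R] (d : ℕ)
    {n : ℕ} (hn : n ≠ 0) :
    ∑ p ∈ antidiagonal n, (-1 : R) ^ p.1 * (d + 1).choose p.1 * (d + p.2).choose d = 0 := by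
  have h := congrArg (PowerSeries.coeff n) (PowerSeries.mk_add_choose_mul_one_sub_pow_eq_one R d)
  rw [mul_comm, PowerSeries.coeff_mul, PowerSeries.coeff_one, if_neg hn] at h
  simpa only [coeff_one_sub_X_pow, PowerSeries.coeff_mk] using h

theorem choose_sub_mul_choose (n : ℕ) {k t : ℕ} (htk : t ≤ k) :
    (n - t).choose k * k.choose t = (n - t).choose (k - t) * (n - k).choose t := by
  rw [← Nat.choose_symm htk, Nat.choose_mul (Nat.sub_le k t), Nat.sub_sub, Nat.sub_sub_self htk,
    Nat.add_sub_cancel' htk]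

section SwitchWeight

open Finset

/-- The edge gadget: for a `t`-subset `e` of a `(k + t)`-set `J`, the weights
`switchWeight t k #(K ∩ e)` of the `k`-subsets `K` of `J` add up to `1` over the `K` containing `e`
and to `0` over the `K` containing any other given `t`-subset. Only the values with `j ≤ t < k`
matter; they are the unique solution of the triangular system `sum_choose_mul_switchWeight`. -/
def switchWeight (t k j : ℕ) : ℚ :=
  (-1) ^ (t + j) * ((k - t) / (k - j)) / k.choose j

theorem abs_switchWeight_le {t k j : ℕ} (htk : t < k) (hj : j ≤ t) :
    |switchWeight t k j| ≤ 1 / k.choose j := by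
  have htk' : (t : ℚ) < k := mod_cast htk
  have hj' : (j : ℚ) ≤ t := mod_cast hj
  rw [switchWeight, abs_div, abs_mul, abs_neg_one_pow, one_mul, Nat.abs_cast]
  gcongr
  rw [abs_of_nonneg (div_nonneg (by linarith) (by linarith)), div_le_one (by linarith)]
  linarith

theorem switchWeight_self {t k : ℕ} (htk : t < k) : switchWeight t k t = 1 / k.choose t := by
  have htk' : (k : ℚ) - t ≠ 0 := sub_ne_zero.2 (mod_cast htk.ne')
  rw [switchWeight, (Even.add_self t).neg_one_pow, div_self htk', one_mul]

theorem choose_mul_switchWeight (p q i d : ℕ) :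
    ((p + q + i).choose q : ℚ) * switchWeight (i + (d + 1)) (p + q + (i + (d + 1))) (i + p) =
      (-1) ^ (d + 1) * ((p + q) * (p + q + i).factorial * d.factorial /
        (p + q + (i + (d + 1))).factorial) * ((-1) ^ p * (d + q).choose d) := by
  have hsign : (-1 : ℚ) ^ (i + (d + 1) + (i + p)) = (-1) ^ (d + 1) * (-1) ^ p := by
    rw [show i + (d + 1) + (i + p) = i + i + (d + 1 + p) by ring, pow_add,
      (Even.add_self i).neg_one_pow, one_mul, pow_add]
  have hchoose₁ : ((p + q + i).choose q : ℚ) =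
      (p + q + i).factorial / (q.factorial * (i + p).factorial) := by
    rw [show p + q + i = q + (i + p) by ring, Nat.cast_add_choose]
  have hchoose₂ : ((p + q + (i + (d + 1))).choose (i + p) : ℚ) =
      (p + q + (i + (d + 1))).factorial / ((i + p).factorial * (d + q + 1).factorial) := by
    rw [show p + q + (i + (d + 1)) = (i + p) + (d + q + 1) by ring, Nat.cast_add_choose]
  have hfac : ∀ n : ℕ, (n.factorial : ℚ) ≠ 0 := fun n => mod_cast n.factorial_ne_zero
  have hdq : (d + q + 1 : ℚ) ≠ 0 := by positivity
  have hnum : ((p + q + (i + (d + 1)) : ℕ) : ℚ) - (i + (d + 1) : ℕ) = p + q := by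
    push_cast; ring
  have hden : ((p + q + (i + (d + 1)) : ℕ) : ℚ) - (i + p : ℕ) = d + q + 1 := by
    push_cast; ring
  rw [switchWeight, hsign, hnum, hden, hchoose₁, hchoose₂, Nat.cast_add_choose,
    Nat.factorial_succ (d + q)]
  have := hfac (i + p)
  have := hfac (p + q + (i + (d + 1)))
  have := hfac q
  have := hfac d
  have := hfac (d + q)
  push_cast
  field_simp

theorem sum_choose_mul_switchWeight {t k i : ℕ} (htk : t < k) (hi : i ≤ t) :
    ∑ p ∈ antidiagonal (k - t), ((t - i).choose p.1 * (k - t + i).choose p.2) •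
      switchWeight t k (i + p.1) = if i = t then 1 else 0 := by
  obtain ⟨a, rfl⟩ := Nat.exists_eq_add_of_le' htk.le
  obtain ⟨s, rfl⟩ := Nat.exists_eq_add_of_le hi
  have ha : a ≠ 0 := by omega
  simp only [Nat.add_sub_cancel, Nat.add_sub_cancel_left]
  rcases s with _ | d
  · simp only [add_zero] at htk ⊢
    have hchoose : ((a + i).choose i : ℚ) ≠ 0 :=
      mod_cast (Nat.choose_pos (Nat.le_add_left i a)).ne'
    rw [if_pos trivial, sum_eq_single_of_mem (0, a) (by simp)]
    · rw [Nat.choose_zero_right, one_mul, nsmul_eq_mul, add_zero, switchWeight_self htk,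
        Nat.choose_symm_add, mul_one_div_cancel hchoose]
    · rintro ⟨p, q⟩ hp hne
      have hp₀ : 0 < p := by grind [HasAntidiagonal.mem_antidiagonal]
      rw [Nat.choose_eq_zero_of_lt hp₀, zero_mul, zero_smul]
  · rw [if_neg (by omega)]
    calc
      _ = ∑ p ∈ antidiagonal a, (-1) ^ (d + 1) * (a * (a + i).factorial * d.factorial /
            (a + (i + (d + 1))).factorial : ℚ) *
            ((-1) ^ p.1 * (d + 1).choose p.1 * (d + p.2).choose d) := by
          refine sum_congr rfl fun ⟨p, q⟩ hp => ?_
          obtain rfl := HasAntidiagonal.mem_antidiagonal.1 hp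
          have h := choose_mul_switchWeight p q i d
          rw [nsmul_eq_mul, Nat.cast_mul, mul_assoc, h]
          push_cast
          ring
      _ = 0 := by
          rw [← mul_sum, sum_antidiagonal_neg_one_pow_mul_choose_mul_choose d ha, mul_zero]

theorem sum_switchWeight {α : Type*} [DecidableEq α] {t k : ℕ} (htk : t < k) {J e T : Finset α}
    (hJ : #J = k + t) (heJ : e ⊆ J) (hTJ : T ⊆ J) (he : #e = t) (hT : #T = t) :
    ∑ K ∈ powersetCard k J with T ⊆ K, switchWeight t k #(K ∩ e) = if T = e then 1 else 0 := by
  have hsplit : #(e ∩ T) + #(e \ T) = t := by rw [card_inter_add_card_sdiff, he]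
  have hrest : #(J \ T) - #(e \ T) = k - t + #(e ∩ T) := by
    rw [card_sdiff_of_subset hTJ]; omega
  have hinter : ∀ S ∈ powersetCard (k - #T) (J \ T),
      #((S ∪ T) ∩ e) = #(e ∩ T) + #(S ∩ (e \ T)) := fun S hS => by
    have hST : Disjoint S T := disjoint_of_subset_left (mem_powersetCard.1 hS).1 sdiff_disjoint
    rw [← card_union_of_disjoint (disjoint_sdiff.mono inter_subset_right inter_subset_right),
      union_inter_distrib_right, union_comm, inter_comm T, ← inter_sdiff_assoc,
      sdiff_eq_self_of_disjoint (hST.mono_left inter_subset_left)]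
  have hTe : #(e ∩ T) = t ↔ T = e :=
    ⟨fun h => by
      have heT : e ∩ T = e := eq_of_subset_of_card_le inter_subset_left (by rw [h, he])
      exact (eq_of_subset_of_card_le (inter_eq_left.1 heT) (by rw [hT, he])).symm,
      fun h => by rw [h, inter_self, he]⟩
  rw [sum_powersetCard_superset hTJ (by omega), sum_congr rfl fun S hS => by rw [hinter S hS],
    sum_powersetCard_card_inter (sdiff_subset_sdiff heJ le_rfl) _
      fun j => switchWeight t k (#(e ∩ T) + j), hrest, hT, show #(e \ T) = t - #(e ∩ T) by omega,
    sum_choose_mul_switchWeight htk (by omega)]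
  exact if_congr hTe rfl rfl

theorem sum_abs_switchWeight_le {α : Type*} [DecidableEq α] {t k : ℕ} (htk : t < k)
    {J K : Finset α} (hJ : #J = k + t) (hKJ : K ⊆ J) (hK : #K = k) :
    ∑ e ∈ powersetCard t J, |switchWeight t k #(K ∩ e)| ≤ 2 ^ t := by
  simp_rw [inter_comm K]
  rw [sum_powersetCard_card_inter hKJ t fun j => |switchWeight t k j|, hJ, hK,
    Nat.add_sub_cancel_left]
  calc
    _ ≤ ∑ p ∈ antidiagonal t, (t.choose p.1 : ℚ) := sum_le_sum fun ⟨i, j⟩ hp => ?_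
    _ = 2 ^ t := by
      rw [Nat.sum_antidiagonal_eq_sum_range_succ_mk]
      exact_mod_cast Nat.sum_range_choose t
  obtain rfl := HasAntidiagonal.mem_antidiagonal.1 hp
  have hpos : (0 : ℚ) < k.choose i := mod_cast Nat.choose_pos (by omega)
  calc
    _ ≤ (k.choose i * (i + j).choose j : ℕ) • (1 / k.choose i : ℚ) := by
      gcongr
      exact abs_switchWeight_le htk (Nat.le_add_right i j)
    _ = (i + j).choose i := by
      rw [nsmul_eq_mul, Nat.cast_mul, Nat.choose_symm_add]
      field_simp

end SwitchWeight

namespace TGraph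

open Finset

section Clique

variable {t : ℕ} {V : Type*} {G : TGraph t V} {S S' e : Finset V}

/-- A clique of `G` is a set of vertices all of whose `t`-subsets are edges; sets of fewer than `t`
vertices qualify vacuously. -/
abbrev IsClique (G : TGraph t V) (S : Finset V) : Prop :=
  powersetCard t S ⊆ G.edges

theorem IsClique.mono (h : G.IsClique S) (hS : S' ⊆ S) : G.IsClique S' :=
  (powersetCard_mono hS).trans h

theorem isClique_of_mem_edges (he : e ∈ G.edges) : G.IsClique e := by
  obtain rfl := G.card_edge e he
  rwa [IsClique, powersetCard_self, singleton_subset_iff]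

variable [Fintype V] [DecidableEq V]

/-- The cliques of `G` with `n` vertices, that is, the vertex sets of its complete subgraphs
`K_n^t`. -/
def cliques (G : TGraph t V) (n : ℕ) : Finset (Finset V) :=
  {K ∈ powersetCard n univ | G.IsClique K}

@[simp]
theorem mem_cliques {n : ℕ} {K : Finset V} : K ∈ G.cliques n ↔ #K = n ∧ G.IsClique K := by
  rw [cliques, mem_filter, mem_powersetCard_univ]

/-- The number of `n`-vertex cliques of `G` containing `e`. -/
def cliqueDegree (G : TGraph t V) (n : ℕ) (e : Finset V) : ℕ :=
  #{K ∈ G.cliques n | e ⊆ K}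

theorem cliqueDegree_add_card_not_isClique (G : TGraph t V) {n : ℕ} (hn : #e ≤ n) :
    G.cliqueDegree n e + #{K ∈ powersetCard n univ | e ⊆ K ∧ ¬G.IsClique K} =
      (Fintype.card V - #e).choose (n - #e) := by
  rw [cliqueDegree, cliques, filter_comm, ← filter_filter, card_filter_add_card_filter_not,
    card_filter_powersetCard_subset e univ n (subset_univ e) hn, card_univ]

theorem cliqueDegree_le (G : TGraph t V) {n : ℕ} (hn : #e ≤ n) :
    G.cliqueDegree n e ≤ (Fintype.card V - #e).choose (n - #e) :=
  (Nat.le_add_right _ _).trans_eq (G.cliqueDegree_add_card_not_isClique hn)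

end Clique

section Density

variable {t : ℕ} {V : Type*} [DecidableEq V]

theorem minDegree_le_degree (G : TGraph t V) (U : Finset V) : G.minDegree #U ≤ G.degree U :=
  Nat.sInf_le ⟨U, rfl, rfl⟩

variable [Fintype V] {G : TGraph t V} {ε : ℝ} {U e : Finset V}

/-- The vertices outside `U` that do not extend `U` to an edge, meant for sets `U` of `t - 1`
vertices. -/
def nonextensions (G : TGraph t V) (U : Finset V) : Finset V :=
  {x | x ∉ U ∧ insert x U ∉ G.edges}

theorem degree_eq_card_filter_insert (G : TGraph t V) (hU : #U + 1 = t) :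
    G.degree U = #{x | x ∉ U ∧ insert x U ∈ G.edges} := by
  symm
  refine card_nbij (insert · U) ?_ ?_ ?_
  · intro x hx
    simp only [coe_filter, mem_univ, true_and, Set.mem_ofPred_eq] at hx ⊢
    exact ⟨hx.2, subset_insert x U⟩
  · intro x hx y _ h
    simp only [coe_filter, mem_univ, true_and, Set.mem_ofPred_eq] at hx
    exact (insert_inj hx.1).1 h
  · intro T hT
    simp only [coe_filter, Set.mem_ofPred_eq] at hT
    obtain ⟨x, hx, rfl⟩ := exists_eq_insert_iff.2 ⟨hT.2, by rw [G.card_edge T hT.1, hU]⟩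
    simp only [coe_filter, mem_univ, true_and]
    exact ⟨x, ⟨hx, hT.1⟩, rfl⟩

theorem degree_add_card_nonextensions (G : TGraph t V) (hU : #U + 1 = t) :
    G.degree U + #(G.nonextensions U) + t = Fintype.card V + 1 := by
  rw [degree_eq_card_filter_insert G hU, nonextensions, ← filter_filter, ← filter_filter,
    card_filter_add_card_filter_not, filter_notMem_eq_sdiff, card_univ_sdiff]
  have := card_le_univ U
  omega

theorem IsDense.card_nonextensions_le (hG : G.IsDense ε) (hU : #U + 1 = t) :
    (#(G.nonextensions U) : ℝ) ≤ ε * (Fintype.card V - t + 1) := by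
  have hmin : (G.minDegree (t - 1) : ℝ) ≤ G.degree U := by
    rw [show t - 1 = #U by omega]
    exact_mod_cast G.minDegree_le_degree U
  have hsum : (G.degree U + #(G.nonextensions U) + t : ℝ) = Fintype.card V + 1 :=
    mod_cast G.degree_add_card_nonextensions hU
  rw [IsDense] at hG
  linarith

theorem IsDense.nonneg (hG : G.IsDense ε) (ht : 1 ≤ t) (htV : t ≤ Fintype.card V) : 0 ≤ ε := by
  obtain ⟨U, -, hU⟩ := exists_subset_card_eq (s := (univ : Finset V)) (n := t - 1)
    (by rw [card_univ]; omega)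
  have htV' : (t : ℝ) ≤ Fintype.card V := mod_cast htV
  have h := (Nat.cast_nonneg _).trans (hG.card_nonextensions_le (U := U) (by omega))
  exact nonneg_of_mul_nonneg_left h (by linarith)

-- A non-clique `K ⊇ e` contains a non-edge `T`; for `x ∈ T \ e`, the set `K` arises from
-- `K \ {x} ⊇ e` by adding a non-extension `x` of the set `T \ {x} ⊆ K \ {x}`.
theorem card_not_isClique_le (ht : 1 ≤ t) {d : ℕ}
    (hd : ∀ U : Finset V, #U + 1 = t → #(G.nonextensions U) ≤ d) (he : e ∈ G.edges) {n : ℕ}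
    (hn : t ≤ n) :
    #{K ∈ powersetCard (n + 1) univ | e ⊆ K ∧ ¬G.IsClique K} ≤
      (Fintype.card V - t).choose (n - t) * (n.choose (t - 1) * d) := by
  have het := G.card_edge e he
  have hcover : {K ∈ powersetCard (n + 1) (univ : Finset V) | e ⊆ K ∧ ¬G.IsClique K} ⊆
      {L ∈ powersetCard n (univ : Finset V) | e ⊆ L}.biUnion fun L =>
        (powersetCard (t - 1) L).biUnion fun U => (G.nonextensions U).image (insert · L) := by
    intro K hK
    simp only [mem_filter, mem_powersetCard_univ] at hK
    obtain ⟨hKn, heK, hK⟩ := hK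
    obtain ⟨T, hT, hTG⟩ := not_subset.1 hK
    rw [mem_powersetCard] at hT
    obtain ⟨x, hxT, hxe⟩ := not_subset.1 fun hTe : T ⊆ e =>
      hTG (isClique_of_mem_edges he (mem_powersetCard.2 ⟨hTe, hT.2⟩))
    simp only [mem_biUnion, mem_image, mem_powersetCard, mem_filter, subset_univ, true_and,
      nonextensions, mem_univ]
    refine ⟨K.erase x, ⟨?_, subset_erase.2 ⟨heK, hxe⟩⟩, T.erase x,
      ⟨erase_subset_erase x hT.1, ?_⟩, x, ⟨notMem_erase x T, ?_⟩, insert_erase (hT.1 hxT)⟩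
    · rw [card_erase_of_mem (hT.1 hxT), hKn, Nat.add_sub_cancel]
    · rw [card_erase_of_mem hxT, hT.2]
    · rwa [insert_erase hxT]
  have hL : #{L ∈ powersetCard n univ | e ⊆ L} = (Fintype.card V - t).choose (n - t) := by
    rw [card_filter_powersetCard_subset e univ n (subset_univ e) (by omega), card_univ, het]
  rw [← hL]
  refine (card_le_card hcover).trans (card_biUnion_le_card_mul _ _ _ fun L hL => ?_)
  have hLn : #L = n := (mem_powersetCard.1 (mem_filter.1 hL).1).2
  rw [← hLn, ← card_powersetCard]
  refine card_biUnion_le_card_mul _ _ _ fun U hU => card_image_le.trans (hd U ?_)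
  rw [(mem_powersetCard.1 hU).2]
  omega

theorem card_not_isClique_mul_le (ht : 1 ≤ t) {d : ℕ}
    (hd : ∀ U : Finset V, #U + 1 = t → #(G.nonextensions U) ≤ d) (he : e ∈ G.edges) {n : ℕ}
    (hn : t ≤ n) :
    #{K ∈ powersetCard (n + 1) univ | e ⊆ K ∧ ¬G.IsClique K} * (Fintype.card V - n) ≤
      (n + 1) ^ t * (Fintype.card V - t).choose (n + 1 - t) * d := by
  obtain ⟨s, rfl⟩ := Nat.exists_eq_add_of_le' ht
  obtain ⟨m, rfl⟩ := Nat.exists_eq_add_of_le hn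
  have hchoose : (m + 1) * (s + 1 + m).choose s ≤ (s + 1 + m + 1) ^ (s + 1) := by
    rw [pow_succ']
    exact Nat.mul_le_mul (by omega)
      ((Nat.choose_le_pow _ _).trans (Nat.pow_le_pow_left (Nat.le_succ _) _))
  have h := card_not_isClique_le ht hd he hn
  rw [show s + 1 + m + 1 - (s + 1) = m + 1 by omega, ← Nat.sub_sub]
  rw [Nat.add_sub_cancel_left, Nat.add_sub_cancel] at h
  set v := Fintype.card V - (s + 1)
  calc
    _ ≤ v.choose m * ((s + 1 + m).choose s * d) * (v - m) := Nat.mul_le_mul_right _ h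
    _ = v.choose m * (v - m) * ((s + 1 + m).choose s * d) := by ring
    _ = (m + 1) * (s + 1 + m).choose s * v.choose (m + 1) * d := by
      rw [← Nat.choose_succ_right_eq]; ring
    _ ≤ (s + 1 + m + 1) ^ (s + 1) * v.choose (m + 1) * d := by gcongr

theorem IsDense.card_not_isClique_le (hG : G.IsDense ε) (ht : 1 ≤ t) (he : e ∈ G.edges) {n : ℕ}
    (hn : t ≤ n) (hv : 2 * n ≤ Fintype.card V + t) :
    (#{K ∈ powersetCard n univ | e ⊆ K ∧ ¬G.IsClique K} : ℝ) ≤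
      2 * ε * n ^ t * (Fintype.card V - t).choose (n - t) := by
  have hε := hG.nonneg ht (by omega)
  rcases hn.eq_or_lt with rfl | hn
  · have hempty : {K ∈ powersetCard t (univ : Finset V) | e ⊆ K ∧ ¬G.IsClique K} = ∅ := by
      refine filter_eq_empty_iff.2 fun K hK hKe => hKe.2 ?_
      rw [← eq_of_subset_of_card_le hKe.1 (by rw [G.card_edge e he, (mem_powersetCard.1 hK).2])]
      exact isClique_of_mem_edges he
    rw [hempty, card_empty, Nat.cast_zero]
    positivity
  obtain ⟨n, rfl⟩ := Nat.exists_eq_add_of_le' (Nat.one_le_of_lt hn)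
  have htV : (0 : ℝ) ≤ ε * (Fintype.card V - t + 1) := by
    have : (t : ℝ) ≤ Fintype.card V := mod_cast (show t ≤ Fintype.card V by omega)
    exact mul_nonneg hε (by linarith)
  have hd : ∀ U : Finset V, #U + 1 = t →
      #(G.nonextensions U) ≤ ⌊ε * (Fintype.card V - t + 1)⌋₊ :=
    fun U hU => Nat.le_floor (hG.card_nonextensions_le hU)
  have hr : (0 : ℝ) < (Fintype.card V - n : ℕ) := mod_cast (show 0 < Fintype.card V - n by omega)
  have hfloor : (⌊ε * (Fintype.card V - t + 1)⌋₊ : ℝ) ≤ 2 * ε * (Fintype.card V - n : ℕ) := by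
    have : (Fintype.card V + 1 : ℝ) ≤ 2 * (Fintype.card V - n : ℕ) + t :=
      mod_cast (show Fintype.card V + 1 ≤ 2 * (Fintype.card V - n) + t by omega)
    calc
      _ ≤ ε * (Fintype.card V - t + 1) := Nat.floor_le htV
      _ ≤ ε * (2 * (Fintype.card V - n : ℕ)) := by gcongr; linarith
      _ = 2 * ε * (Fintype.card V - n : ℕ) := by ring
  refine le_of_mul_le_mul_right ?_ hr
  calc
    _ ≤ ((n + 1 : ℕ) ^ t * (Fintype.card V - t).choose (n + 1 - t) *
          ⌊ε * (Fintype.card V - t + 1)⌋₊ : ℝ) :=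
      mod_cast card_not_isClique_mul_le ht hd he (Nat.lt_succ_iff.1 hn)
    _ ≤ (n + 1 : ℕ) ^ t * (Fintype.card V - t).choose (n + 1 - t) *
          (2 * ε * (Fintype.card V - n : ℕ)) := by gcongr
    _ = _ := by ring

theorem IsDense.le_cliqueDegree (hG : G.IsDense ε) (ht : 1 ≤ t) (he : e ∈ G.edges) {n : ℕ}
    (hn : t ≤ n) (hv : 2 * n ≤ Fintype.card V + t) :
    (1 - 2 * ε * n ^ t) * (Fintype.card V - t).choose (n - t) ≤ G.cliqueDegree n e := by
  have het := G.card_edge e he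
  have hsum := G.cliqueDegree_add_card_not_isClique (het.trans_le hn)
  rw [het] at hsum
  have hbad := hG.card_not_isClique_le ht he hn hv
  rw [← hsum] at hbad ⊢
  push_cast at hbad ⊢
  linarith

end Density

section FractionalCliqueDecomposition

variable {t k : ℕ} {V : Type*} [Fintype V] [DecidableEq V] {G : TGraph t V} {e T K : Finset V}

/-- The function `w` is a fractional decomposition of `G` into copies of `K_k^t`, encoded as a
weighting of vertex sets that is only relevant on the `k`-cliques of `G`. Unlike in a rational
decomposition, weights may vanish. -/
structure IsFractionalCliqueDecomposition (G : TGraph t V) (k : ℕ) (w : Finset V → ℚ) : Prop where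
  nonneg : ∀ K ∈ G.cliques k, 0 ≤ w K
  sum_eq_one : ∀ T ∈ G.edges, ∑ K ∈ G.cliques k with T ⊆ K, w K = 1

theorem isFractionalCliqueDecomposition_one (G : TGraph t V) :
    G.IsFractionalCliqueDecomposition t 1 where
  nonneg _ _ := zero_le_one
  sum_eq_one T hT := by
    have hsingle : {K ∈ G.cliques t | T ⊆ K} = {T} := by
      ext K
      rw [mem_filter, mem_cliques, mem_singleton]
      constructor
      · rintro ⟨⟨hK, -⟩, hTK⟩
        exact (eq_of_subset_of_card_le hTK (by rw [hK, G.card_edge T hT])).symm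
      · rintro rfl
        exact ⟨⟨G.card_edge K hT, isClique_of_mem_edges hT⟩, Subset.rfl⟩
    rw [hsingle, sum_singleton, Pi.one_apply]

/-- The average, over the `(k + t)`-cliques `J` of `G` containing `e`, of the weighting
`K ↦ switchWeight t k #(K ∩ e)` of the `k`-subsets `K` of `J`. Adding a multiple of it to a
weighting of the `k`-cliques of `G` changes the total weight at `e` and at no other edge.
It is zero if `e` lies in no `(k + t)`-clique. -/
def cliqueSwitch (G : TGraph t V) (k : ℕ) (e K : Finset V) : ℚ :=
  G.cliqueDegree (k + t) (K ∪ e) * switchWeight t k #(K ∩ e) / G.cliqueDegree (k + t) e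

theorem cliqueDegree_union_mul (G : TGraph t V) (n : ℕ) (e K : Finset V) (a : ℚ) :
    G.cliqueDegree n (K ∪ e) * a =
      ∑ J ∈ G.cliques n with e ⊆ J, if K ⊆ J then a else 0 := by
  simp only [cliqueDegree, union_subset_iff]
  rw [← sum_filter, filter_filter, sum_const, nsmul_eq_mul]
  simp only [and_comm]

theorem sum_cliques_cliqueSwitch (htk : t < k) (he : e ∈ G.edges) (hT : T ∈ G.edges)
    (hdeg : G.cliqueDegree (k + t) e ≠ 0) :
    ∑ K ∈ G.cliques k with T ⊆ K, G.cliqueSwitch k e K = if T = e then 1 else 0 := by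
  have hJ : ∀ J ∈ {J ∈ G.cliques (k + t) | e ⊆ J},
      ∑ K ∈ G.cliques k with T ⊆ K, (if K ⊆ J then switchWeight t k #(K ∩ e) else 0) =
        if T = e then 1 else 0 := fun J hJ => by
    obtain ⟨⟨hJc, hJG⟩, heJ⟩ : (#J = k + t ∧ G.IsClique J) ∧ e ⊆ J := by
      rwa [mem_filter, mem_cliques] at hJ
    rw [← sum_filter, filter_filter]
    by_cases hTJ : T ⊆ J
    · rw [← sum_switchWeight htk hJc heJ hTJ (G.card_edge e he) (G.card_edge T hT)]
      refine sum_congr ?_ fun _ _ => rfl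
      ext K
      simp only [mem_filter, mem_cliques, mem_powersetCard]
      exact ⟨fun h => ⟨⟨h.2.2, h.1.1⟩, h.2.1⟩, fun h => ⟨⟨h.1.2, hJG.mono h.1.1⟩, h.2, h.1.1⟩⟩
    · rw [if_neg (by rintro rfl; exact hTJ heJ), filter_false_of_mem, sum_empty]
      exact fun K _ h => hTJ (h.1.trans h.2)
  simp only [cliqueSwitch, cliqueDegree_union_mul]
  rw [← sum_div, sum_comm, sum_congr rfl hJ, sum_const, nsmul_eq_mul,
    div_eq_iff (Nat.cast_ne_zero.2 hdeg), mul_comm, cliqueDegree]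

theorem sum_cliques_sum_mul_cliqueSwitch (htk : t < k)
    (hdeg : ∀ e ∈ G.edges, G.cliqueDegree (k + t) e ≠ 0) (c : Finset V → ℚ) (hT : T ∈ G.edges) :
    ∑ K ∈ G.cliques k with T ⊆ K, ∑ e ∈ G.edges, c e * G.cliqueSwitch k e K = c T := by
  rw [sum_comm, sum_eq_single_of_mem T hT]
  · rw [← mul_sum, sum_cliques_cliqueSwitch htk hT hT (hdeg T hT), if_pos rfl, mul_one]
  · intro e he heT
    rw [← mul_sum, sum_cliques_cliqueSwitch htk he hT (hdeg e he), if_neg heT.symm, mul_zero]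

theorem sum_cliqueDegree_mul_abs_switchWeight_le (htk : t < k) (hK : #K = k) :
    ∑ e ∈ G.edges, G.cliqueDegree (k + t) (K ∪ e) * |switchWeight t k #(K ∩ e)| ≤
      2 ^ t * (Fintype.card V - k).choose t := by
  have hJ : ∀ J ∈ {J ∈ G.cliques (k + t) | K ⊆ J},
      ∑ e ∈ G.edges with e ⊆ J, |switchWeight t k #(K ∩ e)| ≤ 2 ^ t := fun J hJ => by
    rw [mem_filter, mem_cliques] at hJ
    refine le_trans ?_ (sum_abs_switchWeight_le htk hJ.1.1 hJ.2 hK)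
    refine sum_le_sum_of_subset_of_nonneg (fun e he => ?_) fun _ _ _ => abs_nonneg _
    rw [mem_filter] at he
    exact mem_powersetCard.2 ⟨he.2, G.card_edge e he.1⟩
  have hdeg : G.cliqueDegree (k + t) K ≤ (Fintype.card V - k).choose t := by
    have h := G.cliqueDegree_le (e := K) (n := k + t) (by omega)
    rwa [hK, Nat.add_sub_cancel_left] at h
  simp only [union_comm K, cliqueDegree_union_mul]
  simp only [sum_filter] at hJ
  rw [sum_comm]
  calc
    _ ≤ #{J ∈ G.cliques (k + t) | K ⊆ J} • (2 ^ t : ℚ) := sum_le_card_nsmul _ _ _ hJ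
    _ = 2 ^ t * G.cliqueDegree (k + t) K := by rw [nsmul_eq_mul, mul_comm, cliqueDegree]
    _ ≤ 2 ^ t * (Fintype.card V - k).choose t := by gcongr

theorem sum_abs_cliqueSwitch_le (htk : t < k) {N : ℚ} (hN : 0 < N)
    (hdeg : ∀ e ∈ G.edges, N ≤ G.cliqueDegree (k + t) e) (hK : #K = k) :
    ∑ e ∈ G.edges, |G.cliqueSwitch k e K| ≤ 2 ^ t * (Fintype.card V - k).choose t / N := by
  calc
    _ ≤ ∑ e ∈ G.edges, G.cliqueDegree (k + t) (K ∪ e) * |switchWeight t k #(K ∩ e)| / N := by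
      refine sum_le_sum fun e he => ?_
      rw [cliqueSwitch, abs_div, abs_mul, Nat.abs_cast, Nat.abs_cast]
      gcongr
      exact hdeg e he
    _ ≤ _ := by
      rw [← sum_div]
      gcongr
      exact sum_cliqueDegree_mul_abs_switchWeight_le htk hK

theorem abs_one_sub_cliqueDegree_div_choose_le {n : ℕ} (hn : #e ≤ n) (hnV : n ≤ Fintype.card V)
    {δ : ℚ} (h : (1 - δ) * (Fintype.card V - #e).choose (n - #e) ≤ G.cliqueDegree n e) :
    |1 - (G.cliqueDegree n e / (Fintype.card V - #e).choose (n - #e) : ℚ)| ≤ δ := by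
  have hpos : (0 : ℚ) < (Fintype.card V - #e).choose (n - #e) :=
    mod_cast Nat.choose_pos (Nat.sub_le_sub_right hnV _)
  have hle : (G.cliqueDegree n e : ℚ) ≤ (Fintype.card V - #e).choose (n - #e) :=
    mod_cast G.cliqueDegree_le hn
  rw [abs_of_nonneg (sub_nonneg.2 (div_le_one_of_le₀ hle hpos.le)), sub_le_comm]
  exact (le_div_iff₀ hpos).2 h

theorem exists_isFractionalCliqueDecomposition (htk : t < k) (hv : k + t ≤ Fintype.card V)
    (hk : ∀ e ∈ G.edges, (1 - 1 / (2 ^ (t + 1) * k.choose t)) *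
      (Fintype.card V - t).choose (k - t) ≤ (G.cliqueDegree k e : ℚ))
    (hkt : ∀ e ∈ G.edges, (Fintype.card V - t).choose k / 2 ≤ (G.cliqueDegree (k + t) e : ℚ)) :
    ∃ w, G.IsFractionalCliqueDecomposition k w := by
  have hdouble := choose_sub_mul_choose (Fintype.card V) htk.le
  set P := (Fintype.card V - t).choose (k - t)
  set M := (Fintype.card V - t).choose k
  have hP : (0 : ℚ) < P := mod_cast Nat.choose_pos (by omega)
  have hM : (0 : ℚ) < M := mod_cast Nat.choose_pos (by omega)
  have hchoose : (0 : ℚ) < k.choose t := mod_cast Nat.choose_pos htk.le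
  let deficit : Finset V → ℚ := fun e => 1 - G.cliqueDegree k e / P
  have hdeficit : ∀ e ∈ G.edges, |deficit e| ≤ 1 / (2 ^ (t + 1) * k.choose t) := fun e he => by
    have het := G.card_edge e he
    have h := abs_one_sub_cliqueDegree_div_choose_le (G := G) (het.trans_le htk.le) (by omega)
      (by rw [het]; exact hk e he)
    rwa [het] at h
  have habs : ∀ K : Finset V, #K = k →
      |∑ e ∈ G.edges, deficit e * G.cliqueSwitch k e K| ≤ 1 / P := fun K hK => by
    calc
      _ ≤ ∑ e ∈ G.edges, 1 / (2 ^ (t + 1) * k.choose t) * |G.cliqueSwitch k e K| := by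
        refine (abs_sum_le_sum_abs _ _).trans (sum_le_sum fun e he => ?_)
        rw [abs_mul]
        gcongr
        exact hdeficit e he
      _ ≤ 1 / (2 ^ (t + 1) * k.choose t) *
            (2 ^ t * (Fintype.card V - k).choose t / (M / 2)) := by
        rw [← mul_sum]
        gcongr
        exact sum_abs_cliqueSwitch_le htk (half_pos hM) hkt hK
      _ = 1 / P := by
        qify at hdouble
        field_simp
        linear_combination -(2 ^ (t + 1)) * hdouble
  have hdeg : ∀ e ∈ G.edges, G.cliqueDegree (k + t) e ≠ 0 := fun e he =>
    Nat.cast_ne_zero.1 ((half_pos hM).trans_le (hkt e he)).ne'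
  refine ⟨fun K => 1 / P + ∑ e ∈ G.edges, deficit e * G.cliqueSwitch k e K, ⟨fun K hK => ?_,
    fun T hT => ?_⟩⟩
  · linarith [neg_le_of_abs_le (habs K (mem_cliques.1 hK).1)]
  · rw [sum_add_distrib, sum_const, nsmul_eq_mul, ← cliqueDegree,
      sum_cliques_sum_mul_cliqueSwitch htk hdeg deficit hT, mul_one_div, add_sub_cancel]

variable {ε : ℝ}

theorem IsDense.le_cliqueDegree_of_mul_pow_le_one (hG : G.IsDense ε) (ht : 1 ≤ t) (htk : t ≤ k)
    (hv : 2 * k ≤ Fintype.card V + t) (hε : ε * (2 ^ (t + 2) * (k : ℝ) ^ (2 * t)) ≤ 1)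
    (he : e ∈ G.edges) :
    (1 - 1 / (2 ^ (t + 1) * k.choose t)) * (Fintype.card V - t).choose (k - t) ≤
      (G.cliqueDegree k e : ℚ) := by
  have hε₀ := hG.nonneg ht (by omega)
  have hchoose : (k.choose t : ℝ) ≤ (k : ℝ) ^ t := mod_cast Nat.choose_le_pow k t
  have hchoose₀ : (0 : ℝ) < k.choose t := mod_cast Nat.choose_pos htk
  have hloss : 2 * ε * (k : ℝ) ^ t ≤ 1 / (2 ^ (t + 1) * k.choose t) := by
    rw [le_div_iff₀ (by positivity)]
    calc
      _ ≤ 2 * ε * (k : ℝ) ^ t * (2 ^ (t + 1) * (k : ℝ) ^ t) := by gcongr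
      _ = ε * (2 ^ (t + 2) * (k : ℝ) ^ (2 * t)) := by ring
      _ ≤ 1 := hε
  rw [← Rat.cast_le (K := ℝ)]
  push_cast
  exact (hG.le_cliqueDegree ht he htk hv).trans' (by gcongr)

theorem IsDense.choose_div_two_le_cliqueDegree (hG : G.IsDense ε) (ht : 1 ≤ t) (htk : t ≤ k)
    (hv : t + 2 * k ≤ Fintype.card V) (hε : ε * (2 ^ (t + 2) * (k : ℝ) ^ (2 * t)) ≤ 1)
    (he : e ∈ G.edges) :
    (Fintype.card V - t).choose k / 2 ≤ (G.cliqueDegree (k + t) e : ℚ) := by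
  have hε₀ := hG.nonneg ht (by omega)
  have hk : (1 : ℝ) ≤ (k : ℝ) ^ t := one_le_pow₀ (mod_cast ht.trans htk)
  have hdeg := hG.le_cliqueDegree ht he (n := k + t) (by omega) (by omega)
  rw [Nat.add_sub_cancel] at hdeg
  have hpow : ((k + t : ℕ) : ℝ) ^ t ≤ 2 ^ t * (k : ℝ) ^ (2 * t) := by
    calc
      _ ≤ (2 * k : ℝ) ^ t := by gcongr; exact_mod_cast (show k + t ≤ 2 * k by omega)
      _ = 2 ^ t * (k : ℝ) ^ t := mul_pow _ _ _
      _ ≤ 2 ^ t * (k : ℝ) ^ (2 * t) := by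
        rw [two_mul t, pow_add]
        gcongr
        exact le_mul_of_one_le_left (by positivity) hk
  have hloss : 2 * ε * ((k + t : ℕ) : ℝ) ^ t ≤ 1 / 2 := by
    calc
      _ ≤ 2 * ε * (2 ^ t * (k : ℝ) ^ (2 * t)) := by gcongr
      _ = ε * (2 ^ (t + 2) * (k : ℝ) ^ (2 * t)) / 2 := by ring
      _ ≤ 1 / 2 := by gcongr
  rw [← Rat.cast_le (K := ℝ)]
  push_cast
  refine hdeg.trans' ?_
  rw [div_eq_inv_mul]
  gcongr
  linarith

theorem IsDense.exists_isFractionalCliqueDecomposition (hG : G.IsDense ε) (ht : 1 ≤ t)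
    (htk : t ≤ k) (hv : t + 2 * k ≤ Fintype.card V)
    (hε : ε * (2 ^ (t + 2) * (k : ℝ) ^ (2 * t)) ≤ 1) :
    ∃ w, G.IsFractionalCliqueDecomposition k w := by
  rcases htk.eq_or_lt with rfl | htk
  · exact ⟨1, G.isFractionalCliqueDecomposition_one⟩
  · exact TGraph.exists_isFractionalCliqueDecomposition htk (by omega)
      (fun e he => hG.le_cliqueDegree_of_mul_pow_le_one ht htk.le (by omega) hε he)
      fun e he => hG.choose_div_two_le_cliqueDegree ht htk.le hv hε he

end FractionalCliqueDecomposition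

end TGraph

section Equiv

open Finset

theorem exists_perm_map_eq {α : Type*} [Finite α] {A B : Finset α} (h : #A = #B) :
    ∃ σ : Equiv.Perm α, A.map σ.toEmbedding = B := by
  classical
  refine ⟨(equivOfCardEq h).extendSubtype, eq_of_subset_of_card_le (fun y hy => ?_) ?_⟩
  · obtain ⟨x, hx, rfl⟩ := mem_map.1 hy
    exact Equiv.extendSubtype_mem _ x hx
  · rw [card_map, h]

theorem card_filter_map_mem_mul_choose {α β : Type*} [Fintype α] [DecidableEq α] [Fintype β]
    [DecidableEq β] {t : ℕ} {𝓕 : Finset (Finset β)} (h𝓕 : ∀ E ∈ 𝓕, #E = t) {T : Finset α}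
    (hT : #T = t) :
    #{f : α ≃ β | T.map f.toEmbedding ∈ 𝓕} * (Fintype.card α).choose t =
      #𝓕 * Fintype.card (α ≃ β) := by
  have hconst : ∀ S ∈ powersetCard t (univ : Finset α),
      #{f : α ≃ β | S.map f.toEmbedding ∈ 𝓕} = #{f : α ≃ β | T.map f.toEmbedding ∈ 𝓕} := by
    intro S hS
    obtain ⟨σ, rfl⟩ := exists_perm_map_eq (hT.trans (mem_powersetCard.1 hS).2.symm)
    refine card_equiv (σ.symm.equivCongr (Equiv.refl β)) fun f => ?_
    simp only [mem_filter, mem_univ, true_and, map_map]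
    rfl
  have himage : ∀ f : α ≃ β, #{S ∈ powersetCard t univ | S.map f.toEmbedding ∈ 𝓕} = #𝓕 := by
    intro f
    refine card_equiv f.finsetCongr fun S => ?_
    rw [mem_filter, mem_powersetCard_univ, Equiv.finsetCongr_apply, and_iff_right_iff_imp]
    intro hS
    rw [← card_map f.toEmbedding, h𝓕 _ hS]
  calc
    _ = ∑ S ∈ powersetCard t (univ : Finset α), #{f : α ≃ β | S.map f.toEmbedding ∈ 𝓕} := by
      rw [sum_congr rfl hconst, sum_const, card_powersetCard, card_univ, smul_eq_mul, mul_comm]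
    _ = ∑ f : α ≃ β, #{S ∈ powersetCard t univ | S.map f.toEmbedding ∈ 𝓕} :=
      sum_card_bipartiteAbove_eq_sum_card_bipartiteBelow _
    _ = #𝓕 * Fintype.card (α ≃ β) := by
      rw [sum_congr rfl fun f _ => himage f, sum_const, card_univ, smul_eq_mul, mul_comm]

end Equiv

namespace TGraph

open Finset

section RationalDecomposition

variable {t : ℕ} {V X : Type*} {G : TGraph t V} {H : TGraph t X}

/-- The copy of `H` in `G` that the bijection `f` places on the vertices of the clique `K`. -/
def copyOn (H : TGraph t X) {K : Finset V} (hK : G.IsClique K) (f : {x // x ∈ K} ≃ X) :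
    G.Subgraph where
  verts := K
  edges := H.edges.map
    (mapEmbedding (f.symm.toEmbedding.trans (Function.Embedding.subtype _))).toEmbedding
  edges_subset T hT := by
    obtain ⟨E, hE, rfl⟩ := mem_map.1 hT
    refine hK (mem_powersetCard.2 ⟨fun x hx => ?_, (card_map _).trans (H.card_edge E hE)⟩)
    obtain ⟨y, -, rfl⟩ := mem_map.1 hx
    exact (f.symm y).2
  edge_subset_verts T hT x hx := by
    obtain ⟨E, -, rfl⟩ := mem_map.1 hT
    obtain ⟨y, -, rfl⟩ := mem_map.1 hx
    exact (f.symm y).2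

theorem isCopy_copyOn {K : Finset V} (hK : G.IsClique K) (f : {x // x ∈ K} ≃ X) :
    (copyOn H hK f).IsCopy H :=
  ⟨f.symm, fun _ => (mem_map' (mapEmbedding _).toEmbedding).symm⟩

variable [DecidableEq V]

theorem mem_edges_copyOn {K T : Finset V} (hK : G.IsClique K) (f : {x // x ∈ K} ≃ X)
    (hTK : T ⊆ K) :
    T ∈ (copyOn H hK f).edges ↔ (T.subtype (· ∈ K)).map f.toEmbedding ∈ H.edges := by
  have hT : ((T.subtype (· ∈ K)).map f.toEmbedding).map
      (f.symm.toEmbedding.trans (Function.Embedding.subtype _)) = T := by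
    have hf : f.toEmbedding.trans (f.symm.toEmbedding.trans (Function.Embedding.subtype (· ∈ K))) =
        Function.Embedding.subtype (· ∈ K) := by
      ext x
      simp
    rw [map_map, hf, subtype_map_of_mem hTK]
  conv_lhs => rw [← hT]
  exact mem_map' (mapEmbedding _).toEmbedding

theorem card_filter_mem_edges_copyOn_mul_choose [Fintype X] [DecidableEq X] (H : TGraph t X)
    {K T : Finset V} (hK : G.IsClique K) (hKX : #K = Fintype.card X) (hTK : T ⊆ K) (hT : #T = t) :
    #{f : {x // x ∈ K} ≃ X | T ∈ (copyOn H hK f).edges} * (Fintype.card X).choose t =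
      #H.edges * (Fintype.card X).factorial := by
  have hT' : #(T.subtype (· ∈ K)) = t := by
    rw [card_subtype, filter_true_of_mem hTK, hT]
  have hKX' : Fintype.card {x // x ∈ K} = Fintype.card X := by rw [Fintype.card_coe, hKX]
  have h := card_filter_map_mem_mul_choose H.card_edge hT'
  rw [Fintype.card_equiv (Fintype.equivOfCardEq hKX'), hKX'] at h
  simpa only [mem_edges_copyOn hK _ hTK] using h

theorem sum_ite_mem_edges_copyOn [Fintype X] [DecidableEq X] (hH : H.edges.Nonempty)
    {K T : Finset V} (hK : G.IsClique K) (hKX : #K = Fintype.card X) (hT : #T = t) (a : ℚ) :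
    ∑ f : {x // x ∈ K} ≃ X, (if T ∈ (copyOn H hK f).edges then
      a * ((Fintype.card X).choose t / (#H.edges * (Fintype.card X).factorial)) else 0) =
        if T ⊆ K then a else 0 := by
  rw [← sum_filter, sum_const, nsmul_eq_mul]
  split_ifs with hTK
  · have hcount := card_filter_mem_edges_copyOn_mul_choose H hK hKX hTK hT
    qify at hcount
    have hne : (#H.edges * (Fintype.card X).factorial : ℚ) ≠ 0 :=
      mod_cast mul_ne_zero hH.card_pos.ne' (Nat.factorial_ne_zero _)
    rw [mul_left_comm, ← mul_div_assoc, hcount, div_self hne, mul_one]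
  · rw [filter_false_of_mem fun f _ h => hTK ((copyOn H hK f).edge_subset_verts T h),
      card_empty, Nat.cast_zero, zero_mul]

theorem hasRationalDecomposition_of_weights {ι : Type*} (I : Finset ι) (s : ι → G.Subgraph)
    (w : ι → ℚ) (hs : ∀ i ∈ I, (s i).IsCopy H) (hw : ∀ i ∈ I, 0 ≤ w i)
    (hsum : ∀ T ∈ G.edges, ∑ i ∈ I with T ∈ (s i).edges, w i = 1) :
    G.HasRationalDecomposition H := by
  -- A rational decomposition allows one weight per copy, so repeated copies are merged and copies
  -- of total weight zero dropped.
  let W : G.Subgraph →₀ ℚ := ∑ i ∈ I, Finsupp.single (s i) (w i)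
  have hW : ∀ S, W S = ∑ i ∈ I, Finsupp.single (s i) (w i) S := fun S => Finsupp.finsetSum_apply ..
  refine ⟨W.graph, ?_, fun T hT => ?_⟩
  · intro p hp
    obtain ⟨hWp, hp₀⟩ := Finsupp.mem_graph_iff.1 hp
    rw [← hWp, hW] at hp₀ ⊢
    obtain ⟨i, hi, hip⟩ := exists_ne_zero_of_sum_ne_zero hp₀
    refine ⟨(Finsupp.single_apply_ne_zero.1 hip).1 ▸ hs i hi, lt_of_le_of_ne ?_ hp₀.symm⟩
    exact sum_nonneg fun j hj => Finsupp.single_nonneg.2 (hw j hj) _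
  · let atT : G.Subgraph → ℚ → ℚ := fun S a => if T ∈ S.edges then a else 0
    have hzero (S : G.Subgraph) : atT S 0 = 0 := ite_self 0
    have hadd (S : G.Subgraph) (a b : ℚ) : atT S (a + b) = atT S a + atT S b := by
      simp only [atT]
      split_ifs <;> simp
    calc
      ∑ p ∈ W.graph with T ∈ p.1.edges, p.2 = W.sum atT := by
        rw [sum_filter, Finsupp.graph, sum_map]
        rfl
      _ = ∑ i ∈ I, (Finsupp.single (s i) (w i)).sum atT :=
        (Finsupp.sum_finsetSum_index hzero hadd).symm
      _ = ∑ i ∈ I with T ∈ (s i).edges, w i := by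
        rw [sum_filter]
        exact sum_congr rfl fun i _ => Finsupp.sum_single_index (hzero _)
      _ = 1 := hsum T hT

theorem IsFractionalCliqueDecomposition.hasRationalDecomposition [Fintype V] [Fintype X]
    {w : Finset V → ℚ} (hw : G.IsFractionalCliqueDecomposition (Fintype.card X) w)
    (hH : H.edges.Nonempty) : G.HasRationalDecomposition H := by
  classical
  set k := Fintype.card X
  have hclique (K : {K // K ∈ G.cliques k}) : #K.1 = k ∧ G.IsClique K.1 := mem_cliques.1 K.2
  refine hasRationalDecomposition_of_weights
    (univ : Finset (Σ K : {K // K ∈ G.cliques k}, {x // x ∈ K.1} ≃ X))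
    (fun i => copyOn H (hclique i.1).2 i.2)
    (fun i => w i.1 * (k.choose t / (#H.edges * k.factorial)))
    (fun i _ => isCopy_copyOn _ _) (fun i _ => mul_nonneg (hw.nonneg _ i.1.2) (by positivity))
    fun T hT => ?_
  rw [sum_filter, Fintype.sum_sigma, sum_congr rfl fun K _ =>
      sum_ite_mem_edges_copyOn hH (hclique K).2 (hclique K).1 (G.card_edge T hT) (w K),
    sum_coe_sort (G.cliques k) fun K => if T ⊆ K then w K else 0, ← sum_filter]
  exact hw.sum_eq_one T hT

theorem IsDense.hasRationalDecomposition [Fintype V] [Fintype X] {ε : ℝ} {k : ℕ}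
    (hG : G.IsDense ε) (ht : 1 ≤ t) (htk : t ≤ k) (hv : t + 2 * k ≤ Fintype.card V)
    (hε : ε * (2 ^ (t + 2) * (k : ℝ) ^ (2 * t)) ≤ 1) (hX : Fintype.card X = k)
    (hH : H.edges.Nonempty) : G.HasRationalDecomposition H := by
  subst hX
  obtain ⟨w, hw⟩ := hG.exists_isFractionalCliqueDecomposition ht htk hv hε
  exact hw.hasRationalDecomposition hH

end RationalDecomposition

end TGraph

theorem theorem1 (t : ℕ) (ht : 2 ≤ t) :
    ∃ C : ℝ, 0 < C ∧ ∀ k : ℕ, t ≤ k → ∃ v₀ : ℕ,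
      ∀ (V : Type*) [Fintype V] [DecidableEq V], v₀ < Fintype.card V →
        ∀ ε : ℝ, ε < C * (k : ℝ) ^ (-(2 * (t : ℤ))) →
          ∀ G : TGraph t V, G.IsDense ε →
            G.HasRationalDecomposition (TGraph.complete t (Fin k)) ∧
              ∀ (X : Type*) [Fintype X], Fintype.card X = k →
                ∀ H : TGraph t X, H.edges.Nonempty → G.HasRationalDecomposition H := by
  refine ⟨1 / 2 ^ (t + 2), by positivity, fun k htk => ⟨t + 2 * k, ?_⟩⟩
  intro V _ _ hv ε hε G hG
  have hk : (0 : ℝ) < k := mod_cast (show 0 < k by omega)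
  have hpow : (k : ℝ) ^ (-(2 * (t : ℤ))) = 1 / (k : ℝ) ^ (2 * t) := by
    rw [zpow_neg, one_div]
    norm_cast
  rw [hpow, one_div_mul_one_div, lt_div_iff₀ (by positivity)] at hε
  refine ⟨hG.hasRationalDecomposition (by omega) htk hv.le hε.le (Fintype.card_fin k) ?_,
    fun X _ hX H hH => hG.hasRationalDecomposition (by omega) htk hv.le hε.le hX hH⟩
  exact Finset.powersetCard_nonempty.2 (by rwa [Finset.card_fin])
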